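/- Let $(R,\mathfrak m)$ be a commutative Noetherian local ring and let $M$ be a finitely generated $R$-module which is locally free on the punctured spectrum of $R$, i.e. $M_{\mathfrak p}$ is a free $R_{\mathfrak p}$-module for every prime ideal $\mathfrak p\neq\mathfrak m$ of $R$. Let $\operatorname{depth}(R)$ denote the supremum of the lengths of the $R$-regular sequences contained in $\mathfrak m$, and let $\operatorname{pd}_R$ denote projective dimension, with the convention $\operatorname{pd}_R(0)=-\infty$. If $\operatorname{pd}_R(M)\le \operatorname{depth}(R)/2$, then $\operatorname{pd}_R(M\otimes_R M)<\infty$. -/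

import Mathlib

universe u v

/-- The depth of a local ring `R`: the supremum of the lengths of the `R`-regular sequences
contained in the maximal ideal of `R`. -/
noncomputable def localRingDepth (R : Type u) [CommRing R] [IsLocalRing R] : ℕ∞ :=
  ⨆ rs : {rs : List R // RingTheory.Sequence.IsRegular R rs ∧
    ∀ r ∈ rs, r ∈ IsLocalRing.maximalIdeal R}, (rs.1.length : ℕ∞)

/-- The module `M` over the local ring `R` is locally free on the punctured spectrum:
`M_p` is a free `R_p`-module for every prime ideal `p` different from the maximal ideal. -/
def IsLocallyFreeOnPuncturedSpectrum (R : Type u) [CommRing R] [IsLocalRing R]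
    (M : Type v) [AddCommGroup M] [Module R M] : Prop :=
  ∀ p : PrimeSpectrum R, p ≠ IsLocalRing.closedPoint R →
    Module.Free (Localization.AtPrime p.asIdeal) (LocalizedModule p.asIdeal.primeCompl M)

/-!
Write `k` for the residue field and read depth through the vanishing of `Ext^i(k, -)`. Resolve `N`
by finite free modules and tensor with `M`. Each syzygy step `0 → K → F → N → 0` stays exact:
the kernel of `M ⊗ K → M ⊗ F` is `Tor₁(M, N)`, which vanishes on the punctured spectrum because `M`
is locally free there, while `M ⊗ K` has positive depth and so has no nonzero submodule with that
property. Exactness then gives `depth (M ⊗ N) ≥ depth M - pd N`, which keeps the induction going,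
and `pd (M ⊗ N) ≤ pd M + pd N`. The argument needs `pd N ≤ depth M`; since
`depth M ≥ depth R - pd M`, it is enough that `pd M + pd N ≤ depth R`.
-/

open CategoryTheory Abelian Limits IsLocalRing TensorProduct

lemma exists_natCast_eq_of_add_lt_top {x y : WithBot ℕ∞} (hx : x ≠ ⊥) (hy : y ≠ ⊥)
    (h : x + y < ⊤) : ∃ m n : ℕ, x = m ∧ y = n := by
  lift x to ℕ∞ using hx
  lift y to ℕ∞ using hy
  rw [← WithBot.coe_add, ← WithBot.coe_top, WithBot.coe_lt_coe] at h
  obtain ⟨hx_top, hy_top⟩ := WithTop.add_lt_top.mp h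
  lift x to ℕ using hx_top.ne
  lift y to ℕ using hy_top.ne
  exact ⟨x, y, rfl, rfl⟩

section Abelian

attribute [local instance] Abelian.hasFiniteBiproducts

variable {C : Type*} [Category* C] [Abelian C]

lemma hasProjectiveDimensionLT_biproduct {J : Type*} [Finite J] (X : J → C) (n : ℕ)
    [∀ j, HasProjectiveDimensionLT (X j) n] : HasProjectiveDimensionLT (⨁ X) n := by
  cases nonempty_fintype J
  let := HasExt.standard C
  refine (hasProjectiveDimensionLT_iff _ _).mpr fun i hi Y e ↦
    (Ext.biproductAddEquiv (biproduct.isBilimit X) Y i).injective (funext fun j ↦ ?_)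
  exact (Ext.eq_zero_of_hasProjectiveDimensionLT _ n hi).trans
    (Ext.eq_zero_of_hasProjectiveDimensionLT _ n hi).symm

lemma subsingleton_ext_X₃ [HasExt C] {S : ShortComplex C} (hS : S.ShortExact) (X : C) (n : ℕ)
    [Subsingleton (Ext X S.X₂ n)] [Subsingleton (Ext X S.X₁ (n + 1))] :
    Subsingleton (Ext X S.X₃ n) := by
  refine subsingleton_of_forall_eq 0 fun e ↦ ?_
  obtain ⟨x, rfl⟩ := Ext.covariant_sequence_exact₃ X hS e rfl (Subsingleton.elim _ _)
  rw [Subsingleton.elim x 0, Ext.zero_comp]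

end Abelian

section AssociatedPrimes

variable {R : Type*} [CommRing R] [IsNoetherianRing R]

lemma eq_zero_of_forall_associatedPrimes {A : Type*} [AddCommGroup A] [Module R A] {x : A}
    (h : ∀ p ∈ associatedPrimes R A, ∃ s ∉ p, s • x = 0) : x = 0 := by
  by_contra hx
  obtain ⟨p, hp, hle⟩ := exists_le_isAssociatedPrime_of_isNoetherianRing R x hx
  obtain ⟨s, hs, hsx⟩ := h p hp
  exact hs (hle (Submodule.mem_colon_singleton.mpr hsx))

lemma lTensor_injective_of_flat_associatedPrimes {M K F : Type*} [AddCommGroup M] [Module R M]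
    [AddCommGroup K] [Module R K] [AddCommGroup F] [Module R F]
    (h : ∀ (p : Ideal R) [p.IsPrime], p ∈ associatedPrimes R (M ⊗[R] K) →
      Module.Flat R (LocalizedModule p.primeCompl M))
    {f : K →ₗ[R] F} (hf : Function.Injective f) : Function.Injective (f.lTensor M) := by
  refine (injective_iff_map_eq_zero _).mpr fun x hx ↦
    eq_zero_of_forall_associatedPrimes (R := R) fun p hp ↦ ?_
  have : p.IsPrime := hp.isPrime
  have : Module.Flat R (LocalizedModule p.primeCompl M) := h p hp
  let ι := LocalizedModule.mkLinearMap p.primeCompl M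
  have : IsLocalizedModule p.primeCompl (ι.rTensor K) :=
    IsLocalizedModule.rTensor (A := R) (R := R) p.primeCompl ι
  have hx_loc : ι.rTensor K x = 0 := by
    refine Module.Flat.lTensor_preserves_injective_linearMap f hf ?_
    rw [map_zero, ← LinearMap.comp_apply, LinearMap.lTensor_comp_rTensor,
      ← LinearMap.rTensor_comp_lTensor, LinearMap.comp_apply, hx, map_zero]
  obtain ⟨s, hs⟩ := (IsLocalizedModule.eq_zero_iff p.primeCompl (ι.rTensor K)).mp hx_loc
  exact ⟨s, s.2, hs⟩

end AssociatedPrimes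

section TensorProduct

variable {R : Type u} [CommRing R]

/-- Tensoring with a free module of finite rank, identified with a biproduct along a basis. -/
noncomputable def tensorProductIsoBiproduct (M : Type u) {N : Type u} [AddCommGroup M] [Module R M]
    [AddCommGroup N] [Module R N] {ι : Type} [Fintype ι] [DecidableEq ι] (b : Module.Basis ι R N) :
    ModuleCat.of R (M ⊗[R] N) ≅ ⨁ fun _ : ι ↦ ModuleCat.of R M :=
  ((TensorProduct.congr (LinearEquiv.refl R M) b.equivFun).trans
    (TensorProduct.piScalarRight R R M ι)).toModuleIso ≪≫
    (ModuleCat.biproductIsoPi fun _ : ι ↦ ModuleCat.of R M).symm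

lemma hasProjectiveDimensionLT_tensorProduct_of_free (M N : Type u) [AddCommGroup M] [Module R M]
    [AddCommGroup N] [Module R N] [Module.Finite R N] [Module.Free R N] [StrongRankCondition R]
    (n : ℕ) [HasProjectiveDimensionLT (ModuleCat.of R M) n] :
    HasProjectiveDimensionLT (ModuleCat.of R (M ⊗[R] N)) n :=
  have := hasProjectiveDimensionLT_biproduct
    (fun _ : Fin (Module.finrank R N) ↦ ModuleCat.of R M) n
  hasProjectiveDimensionLT_of_iso (tensorProductIsoBiproduct M (Module.finBasis R N)).symm n

lemma exists_surjective_hasProjectiveDimensionLE_ker (N : Type u) [AddCommGroup N] [Module R N]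
    [Module.Finite R N] (k : ℕ) [hN : HasProjectiveDimensionLE (ModuleCat.of R N) (k + 1)] :
    ∃ (m : ℕ) (π : (Fin m → R) →ₗ[R] N), Function.Surjective π ∧
      HasProjectiveDimensionLE (ModuleCat.of R (LinearMap.ker π)) k := by
  obtain ⟨m, π, hπ⟩ := Module.Finite.exists_fin' R N
  exact ⟨m, π, hπ, ((LinearMap.shortExact_shortComplexKer hπ).hasProjectiveDimensionLT_X₃_iff k
    inferInstance).mp hN⟩

end TensorProduct

section Depth

variable {R : Type u} [CommRing R] [IsLocalRing R]

/-- `Ext^i` from the residue field to `M` vanishes for all `i < n`. For a nonzero finitely generated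
module over a Noetherian local ring this says that `M` has depth at least `n`; defining it through
`Ext` makes it pass along short exact sequences. The zero module satisfies it for every `n`. -/
def HasDepthGE (M : ModuleCat.{u} R) (n : ℕ) : Prop :=
  ∀ i < n, Subsingleton (Ext (ModuleCat.of R (ResidueField R)) M i)

lemma HasDepthGE.mono {M : ModuleCat.{u} R} {m n : ℕ} (h : HasDepthGE M n) (hmn : m ≤ n) :
    HasDepthGE M m :=
  fun i hi ↦ h i (hi.trans_le hmn)

lemma HasDepthGE.of_iso {M N : ModuleCat.{u} R} {n : ℕ} (h : HasDepthGE M n) (e : M ≅ N) :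
    HasDepthGE N n := fun i hi ↦
  have := h i hi
  ((extFunctorObj _ i).mapIso e.symm).addCommGroupIsoToAddEquiv.subsingleton (β := Ext _ M i)

lemma HasDepthGE.biproduct {J : Type*} [Finite J] {M : J → ModuleCat.{u} R} {n : ℕ}
    (h : ∀ j, HasDepthGE (M j) n) : HasDepthGE (⨁ M) n := by
  cases nonempty_fintype J
  intro i hi
  have := fun j ↦ h j i hi
  exact (Ext.addEquivBiproduct _ (biproduct.isBilimit M) i).subsingleton

lemma HasDepthGE.X₃ {S : ShortComplex (ModuleCat.{u} R)} (hS : S.ShortExact) {n : ℕ}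
    (h₁ : HasDepthGE S.X₁ (n + 1)) (h₂ : HasDepthGE S.X₂ n) : HasDepthGE S.X₃ n := fun i hi ↦
  have := h₁ (i + 1) (by omega)
  have := h₂ i hi
  subsingleton_ext_X₃ hS _ i

lemma HasDepthGE.tensorProduct_of_free {M N : Type u} [AddCommGroup M] [Module R M]
    [AddCommGroup N] [Module R N] [Module.Finite R N] [Module.Free R N] {n : ℕ}
    (h : HasDepthGE (ModuleCat.of R M) n) : HasDepthGE (ModuleCat.of R (M ⊗[R] N)) n :=
  (HasDepthGE.biproduct fun _ ↦ h).of_iso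
    (tensorProductIsoBiproduct M (Module.finBasis R N)).symm

variable [IsNoetherianRing R]

lemma HasDepthGE.maximalIdeal_notMem_associatedPrimes {M : ModuleCat.{u} R}
    (h : HasDepthGE M 1) : maximalIdeal R ∉ associatedPrimes R M := by
  intro hmem
  obtain ⟨-, g, hg⟩ := (isAssociatedPrime_iff_exists_injective_linearMap _ _).mp hmem
  have := h 0 one_pos
  have : Subsingleton (ResidueField R →ₗ[R] M) :=
    ((Ext.addEquiv₀ (X := ModuleCat.of R (ResidueField R))).trans
      ModuleCat.homAddEquiv).symm.subsingleton
  have hg_zero : g = 0 := Subsingleton.elim (α := ResidueField R →ₗ[R] M) g 0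
  exact one_ne_zero (α := ResidueField R) (hg (by rw [hg_zero]; rfl))

lemma hasDepthGE_of_le_localRingDepth {n : ℕ} (h : (n : ℕ∞) ≤ localRingDepth R) :
    HasDepthGE (ModuleCat.of R R) n := by
  intro i hi
  obtain ⟨⟨rs, hreg, hmem⟩, hlt⟩ := lt_iSup_iff.mp ((Nat.cast_lt.mpr hi).trans_le h)
  refine ModuleCat.subsingleton_ext_of_exists_isRegular (maximalIdeal R)
    (ModuleCat.of R (ResidueField R)) ?_ (ModuleCat.of R R) ?_ rs hmem hreg i (Nat.cast_lt.mp hlt)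
  · change Module.support R (R ⧸ maximalIdeal R) ⊆ _
    rw [Module.support_eq_zeroLocus, Ideal.annihilator_quotient]
  · simpa using (maximalIdeal.isMaximal R).ne_top.lt_top

lemma localRingDepth_le_ringKrullDim : (localRingDepth R : WithBot ℕ∞) ≤ ringKrullDim R := by
  obtain ⟨d, hd⟩ := WithBot.ne_bot_iff_exists.mp (ringKrullDim_ne_bot (R := R))
  rw [← hd, WithBot.coe_le_coe]
  refine iSup_le fun ⟨rs, hreg, _⟩ ↦ ?_
  have : Nontrivial (R ⧸ Ideal.ofList rs) :=
    Ideal.Quotient.nontrivial_iff.mpr fun htop ↦ hreg.top_ne_smul (by simp [htop])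
  rw [← WithBot.coe_le_coe, hd, ← ringKrullDim_add_length_eq_ringKrullDim_of_isRegular rs hreg]
  exact le_add_of_nonneg_left ringKrullDim_nonneg_of_nontrivial

variable (R) in
lemma localRingDepth_lt_top : (localRingDepth R : WithBot ℕ∞) < ⊤ :=
  localRingDepth_le_ringKrullDim.trans_lt ringKrullDim_lt_top

end Depth

section LocallyFree

variable {R : Type u} [CommRing R] [IsLocalRing R]

lemma isLocallyFreeOnPuncturedSpectrum_self : IsLocallyFreeOnPuncturedSpectrum R R := fun p _ ↦
  Module.Free.of_equiv (LinearEquiv.refl _ (Localization.AtPrime p.asIdeal))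

variable [IsNoetherianRing R] {M N : Type u} [AddCommGroup M] [Module R M]
  [AddCommGroup N] [Module R N]

lemma IsLocallyFreeOnPuncturedSpectrum.lTensor_injective
    (hM : IsLocallyFreeOnPuncturedSpectrum R M) {K F : Type u} [AddCommGroup K] [Module R K]
    [AddCommGroup F] [Module R F] (hK : HasDepthGE (ModuleCat.of R (M ⊗[R] K)) 1)
    {f : K →ₗ[R] F} (hf : Function.Injective f) : Function.Injective (f.lTensor M) := by
  refine lTensor_injective_of_flat_associatedPrimes (fun p hprime hp ↦ ?_) hf
  have : Module.Free (Localization.AtPrime p) (LocalizedModule p.primeCompl M) :=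
    hM ⟨p, hprime⟩ fun h ↦ hK.maximalIdeal_notMem_associatedPrimes
      (by rwa [show p = maximalIdeal R from congrArg PrimeSpectrum.asIdeal h] at hp)
  exact Module.Flat.trans R (Localization.AtPrime p) _

lemma IsLocallyFreeOnPuncturedSpectrum.shortExact_lTensor
    (hM : IsLocallyFreeOnPuncturedSpectrum R M) {F : Type u} [AddCommGroup F] [Module R F]
    {π : F →ₗ[R] N} (hπ : Function.Surjective π)
    (hK : HasDepthGE (ModuleCat.of R (M ⊗[R] LinearMap.ker π)) 1) :
    (ModuleCat.shortComplexOfCompEqZero ((LinearMap.ker π).subtype.lTensor M) (π.lTensor M)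
      (by rw [← LinearMap.lTensor_comp, LinearMap.comp_ker_subtype, LinearMap.lTensor_zero])
      ).ShortExact :=
  ModuleCat.shortComplex_shortExact _ (lTensor_exact M (LinearMap.exact_subtype_ker_map π) hπ)
    (hM.lTensor_injective hK (Submodule.subtype_injective _)) (LinearMap.lTensor_surjective M hπ)

variable [Module.Finite R N]

omit [IsNoetherianRing R] in
lemma free_of_hasProjectiveDimensionLE_zero [hN : HasProjectiveDimensionLE (ModuleCat.of R N) 0] :
    Module.Free R N :=
  have : Module.Projective R N := (IsProjective.iff_projective _).mpr
    ((projective_iff_hasProjectiveDimensionLE_zero _).mpr hN)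
  Module.free_of_flat_of_isLocalRing

theorem HasDepthGE.tensorProduct (hM : IsLocallyFreeOnPuncturedSpectrum R M) {n k : ℕ}
    (hdepth : HasDepthGE (ModuleCat.of R M) (n + k))
    (hN : HasProjectiveDimensionLE (ModuleCat.of R N) k) :
    HasDepthGE (ModuleCat.of R (M ⊗[R] N)) n := by
  induction k generalizing N n with
  | zero =>
    have := free_of_hasProjectiveDimensionLE_zero (R := R) (N := N)
    exact hdepth.tensorProduct_of_free
  | succ k ih =>
    obtain ⟨m, π, hπ, hker⟩ := exists_surjective_hasProjectiveDimensionLE_ker (R := R) N k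
    have hK : HasDepthGE (ModuleCat.of R (M ⊗[R] LinearMap.ker π)) (n + 1) :=
      ih (hdepth.mono (by omega)) hker
    exact .X₃ (hM.shortExact_lTensor hπ (hK.mono (by omega))) hK
      (hdepth.mono (by omega)).tensorProduct_of_free

theorem hasDepthGE_of_hasProjectiveDimensionLE {n k : ℕ}
    (hdepth : HasDepthGE (ModuleCat.of R R) (n + k))
    (hN : HasProjectiveDimensionLE (ModuleCat.of R N) k) : HasDepthGE (ModuleCat.of R N) n :=
  (hdepth.tensorProduct isLocallyFreeOnPuncturedSpectrum_self hN).of_iso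
    (TensorProduct.lid R N).toModuleIso

theorem hasProjectiveDimensionLE_tensorProduct (hM : IsLocallyFreeOnPuncturedSpectrum R M)
    {n k : ℕ} (hdepth : HasDepthGE (ModuleCat.of R M) k)
    (hpdM : HasProjectiveDimensionLE (ModuleCat.of R M) n)
    (hpdN : HasProjectiveDimensionLE (ModuleCat.of R N) k) :
    HasProjectiveDimensionLE (ModuleCat.of R (M ⊗[R] N)) (n + k) := by
  induction k generalizing N with
  | zero =>
    have := free_of_hasProjectiveDimensionLE_zero (R := R) (N := N)
    exact hasProjectiveDimensionLT_tensorProduct_of_free M N (n + 1)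
  | succ k ih =>
    obtain ⟨m, π, hπ, hker⟩ := exists_surjective_hasProjectiveDimensionLE_ker (R := R) N k
    have hK : HasDepthGE (ModuleCat.of R (M ⊗[R] LinearMap.ker π)) 1 :=
      .tensorProduct hM (hdepth.mono (by omega)) hker
    have : HasProjectiveDimensionLT (ModuleCat.of R M) (n + k + 1 + 1) :=
      hasProjectiveDimensionLT_of_ge _ (n + 1) _ (by omega)
    exact (hM.shortExact_lTensor hπ hK).hasProjectiveDimensionLT_X₃ (n + k + 1)
      (ih (hdepth.mono (by omega)) hker)
      (hasProjectiveDimensionLT_tensorProduct_of_free M (Fin m → R) _)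

end LocallyFree

theorem mainTheorem9_general (R : Type u) [CommRing R] [IsLocalRing R] [IsNoetherianRing R]
    (M N : Type u) [AddCommGroup M] [Module R M] [Module.Finite R M]
    [AddCommGroup N] [Module R N] [Module.Finite R N]
    (hfree : IsLocallyFreeOnPuncturedSpectrum R M)
    (hpd : projectiveDimension (ModuleCat.of R M) + projectiveDimension (ModuleCat.of R N) ≤
      (localRingDepth R : WithBot ℕ∞)) :
    projectiveDimension (ModuleCat.of R (M ⊗[R] N)) ≤
      projectiveDimension (ModuleCat.of R M) + projectiveDimension (ModuleCat.of R N) := by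
  by_cases htensor : IsZero (ModuleCat.of R (M ⊗[R] N))
  · exact ((projectiveDimension_eq_bot_iff _).mpr htensor).trans_le bot_le
  have hM : ¬ IsZero (ModuleCat.of R M) := fun h ↦ htensor <|
    have : Subsingleton M := ModuleCat.isZero_iff_subsingleton.mp h
    ModuleCat.isZero_of_iff_subsingleton.mpr inferInstance
  have hN : ¬ IsZero (ModuleCat.of R N) := fun h ↦ htensor <|
    have : Subsingleton N := ModuleCat.isZero_iff_subsingleton.mp h
    ModuleCat.isZero_of_iff_subsingleton.mpr inferInstance
  obtain ⟨m, n, hm, hn⟩ := exists_natCast_eq_of_add_lt_top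
    ((projectiveDimension_eq_bot_iff _).not.mpr hM) ((projectiveDimension_eq_bot_iff _).not.mpr hN)
    (hpd.trans_lt (localRingDepth_lt_top R))
  rw [hm, hn] at hpd ⊢
  norm_cast at hpd ⊢
  have hpdM : HasProjectiveDimensionLE (ModuleCat.of R M) m :=
    (projectiveDimension_le_iff _ m).mp hm.le
  have hpdN : HasProjectiveDimensionLE (ModuleCat.of R N) n :=
    (projectiveDimension_le_iff _ n).mp hn.le
  have hdepth : HasDepthGE (ModuleCat.of R M) n :=
    hasDepthGE_of_hasProjectiveDimensionLE
      (hasDepthGE_of_le_localRingDepth (by rwa [add_comm])) hpdM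
  exact (projectiveDimension_le_iff _ _).mpr
    (hasProjectiveDimensionLE_tensorProduct hfree hdepth hpdM hpdN)

theorem mainTheorem9 (R : Type u) [CommRing R] [IsLocalRing R] [IsNoetherianRing R]
    (M : Type u) [AddCommGroup M] [Module R M] [Module.Finite R M]
    (hfree : IsLocallyFreeOnPuncturedSpectrum R M)
    (hpd : 2 * CategoryTheory.projectiveDimension (ModuleCat.of R M) ≤
      ((localRingDepth R : ℕ∞) : WithBot ℕ∞)) :
    CategoryTheory.projectiveDimension (ModuleCat.of R (TensorProduct R M M)) < ⊤ := by
  have hpd_add := two_mul (projectiveDimension (ModuleCat.of R M)) ▸ hpd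
  exact (mainTheorem9_general R M M hfree hpd_add).trans_lt
    (hpd_add.trans_lt (localRingDepth_lt_top R))
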